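/- Let $\mathbb{T}^d=\mathbb{R}^d/\mathbb{Z}^d$ and $T>0$, and write $L^pL^q$ for $L^p([0,T];L^q(\mathbb{T}^d))$; here $L^\infty L^\infty$ is $L^\infty([0,T]\times\mathbb{T}^d)$, the dual of $L^1L^1$. Let $u\in L^1([0,T];L^1(\mathbb{T}^d;\mathbb{R}^d))$ with $\nabla\cdot u=0$ in the sense of distributions, and let $f_0\in L^\infty(\mathbb{T}^d)$. For $\nu\ge 0$, a weak solution of $\partial_t g+\nabla\cdot(ug)-\nu\Delta g=0$ along $u$ with initial data $g_0\in L^1(\mathbb{T}^d)$ is a function $g\in L^1L^1$ with $ug\in L^1L^1$ such that $$\int_{\mathbb{T}^d\times[0,T]} g\left(\partial_t\phi+u\cdot\nabla\phi+\nu\Delta\phi\right)dx\,dt=-\int_{\mathbb{T}^d}g_0\,\phi(\cdot,0)\,dx\qquad\text{for all }\phi\in C_c^\infty(\mathbb{T}^d\times[0,T)).$$ For $\nu=0$ this is the transport equation. A weak solution $g$ of the transport equation with initial data $g_0$ is renormalised if, for every bounded continuous $\beta:\mathbb{R}\to\mathbb{R}$, $\beta(g)$ is a weak solution of the transport equation along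 $u$ with initial data $\beta(g_0)$. Suppose that the transport equation along $u$ with initial data $f_0$ has a weak solution $f\in L^\infty L^\infty$, that $f$ is the only weak solution in the class $L^\infty L^\infty$ (up to equality almost everywhere), and that $f$ is renormalised. For each $\nu>0$ let $f^\nu$ be any weak solution of $\partial_t f^\nu+\nabla\cdot(uf^\nu)-\nu\Delta f^\nu=0$ along $u$ with initial data $f_0$. Suppose that $f^\nu$ (has a representative that) is a weak-$*$ continuous map $[0,T]\to L^\infty(\mathbb{T}^d)$ and satisfies $$\|f^\nu(\cdot,t)\|_{L^p(\mathbb{T}^d)}\le\|f_0\|_{L^p(\mathbb{T}^d)}\qquad\text{for all }t\in[0,T]\text{ and all }p\in[1,\infty].$$ Then, as $\nu\to0$, $f^\nu\to f$ weak-$*$ in $L^\infty L^\infty$ and, for each $p\in[1,\infty)$, strongly in $L^pL^p$. If additionally $f\in C^0([0,T];L^1(\mathbb{T}^d))$, then for each $p\in[1,\infty)$ also $f^\nu\to f$ strongly in $L^\infty L^p$ as $\nu\to0$. -/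

import Mathlib

open MeasureTheory Filter Topology Set
open scoped ENNReal BoundedContinuousFunction

namespace VanishingViscosity

noncomputable section

/-- The flat torus `ℝ^d / ℤ^d`; its `volume` is Lebesgue measure of total mass one. -/
abbrev Torus (d : ℕ) : Type := UnitAddTorus (Fin d)

/-- Lebesgue measure on the time interval `[0,T]`. -/
abbrev timeMeasure (T : ℝ) : Measure ℝ := volume.restrict (Icc 0 T)

/-- Lebesgue measure on `[0,T] × 𝕋^d`. Space-time points are written `(t, x)`. -/
abbrev spaceTime (d : ℕ) (T : ℝ) : Measure (ℝ × Torus d) :=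
  (timeMeasure T).prod (volume : Measure (Torus d))

/-- The norm of `L^p([0,T]; L^q(𝕋^d; E))`. -/
def mixedNorm {d : ℕ} {E : Type*} [NormedAddCommGroup E] (T : ℝ) (p q : ℝ≥0∞)
    (f : ℝ → Torus d → E) : ℝ≥0∞ :=
  eLpNorm (fun t => eLpNorm (f t) q volume) p (timeMeasure T)

/-- `f ∈ L^p([0,T]; L^q(𝕋^d; E))`, for functions on space-time. For `p = q = ∞` this is
`L^∞([0,T] × 𝕋^d)`, the dual of `L^1([0,T]; L^1(𝕋^d))`. -/
def MemMixed {d : ℕ} {E : Type*} [NormedAddCommGroup E] (T : ℝ) (p q : ℝ≥0∞)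
    (f : ℝ → Torus d → E) : Prop :=
  AEStronglyMeasurable (fun z : ℝ × Torus d => f z.1 z.2) (spaceTime d T) ∧
    mixedNorm T p q f < ∞

/-- The `i`-th partial derivative of a function on the torus. -/
def partialDeriv {d : ℕ} (i : Fin d) (φ : Torus d → ℝ) (x : Torus d) : ℝ :=
  deriv (fun s : ℝ => φ (x + Pi.single i (s : UnitAddCircle))) 0

/-- The spatial gradient. -/
def grad {d : ℕ} (φ : Torus d → ℝ) (x : Torus d) : EuclideanSpace ℝ (Fin d) :=
  WithLp.toLp 2 (fun i => partialDeriv i φ x)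

/-- The spatial Laplacian. -/
def laplacian {d : ℕ} (φ : Torus d → ℝ) (x : Torus d) : ℝ :=
  ∑ i, partialDeriv i (partialDeriv i φ) x

/-- The time derivative. -/
def timeDeriv {d : ℕ} (φ : ℝ → Torus d → ℝ) (t : ℝ) (x : Torus d) : ℝ :=
  deriv (fun s => φ s x) t

/-- Smoothness on `ℝ × 𝕋^d`: the periodic lift to `ℝ × ℝ^d` is `C^∞`. -/
def IsSmooth {d : ℕ} (φ : ℝ → Torus d → ℝ) : Prop :=
  ContDiff ℝ ((⊤ : ℕ∞) : WithTop ℕ∞) (fun z : ℝ × (Fin d → ℝ) => φ z.1 (fun i => (z.2 i : UnitAddCircle)))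

/-- Test functions in `C_c^∞(𝕋^d × [0,T))`: restrictions to `t ≥ 0` of smooth functions that
vanish from some time before `T` on. They need not vanish at `t = 0`. -/
def IsTestHalfOpen {d : ℕ} (T : ℝ) (φ : ℝ → Torus d → ℝ) : Prop :=
  IsSmooth φ ∧ ∃ b < T, ∀ t, b ≤ t → ∀ x, φ t x = 0

/-- Test functions in `C_c^∞(𝕋^d × (0,T))`. -/
def IsTestOpen {d : ℕ} (T : ℝ) (φ : ℝ → Torus d → ℝ) : Prop :=
  IsSmooth φ ∧ ∃ a b, 0 < a ∧ b < T ∧ ∀ t, t ∉ Icc a b → ∀ x, φ t x = 0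

/-- `∇ · u = 0` in the sense of distributions on `𝕋^d × (0,T)`. -/
def IsDivFree {d : ℕ} (T : ℝ) (u : ℝ → Torus d → EuclideanSpace ℝ (Fin d)) : Prop :=
  ∀ φ : ℝ → Torus d → ℝ, IsTestOpen T φ →
    ∫ z, inner ℝ (u z.1 z.2) (grad (φ z.1) z.2) ∂(spaceTime d T) = 0

/-- `f` is a weak solution of `∂f/∂t + ∇·(u f) = 0` with initial data `f₀`. -/
structure IsWeakSolTE {d : ℕ} (T : ℝ) (u : ℝ → Torus d → EuclideanSpace ℝ (Fin d))
    (f₀ : Torus d → ℝ) (f : ℝ → Torus d → ℝ) : Prop where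
  mem : MemMixed T 1 1 f
  mem_flux : MemMixed T 1 1 (fun t x => f t x • u t x)
  mem_init : MemLp f₀ 1 volume
  weak_eq : ∀ φ : ℝ → Torus d → ℝ, IsTestHalfOpen T φ →
    ∫ z, f z.1 z.2 * (timeDeriv φ z.1 z.2 + inner ℝ (u z.1 z.2) (grad (φ z.1) z.2))
        ∂(spaceTime d T)
      = - ∫ x, f₀ x * φ 0 x

/-- `f` is a weak solution of `∂f/∂t + ∇·(u f) - ν Δf = 0` with initial data `f₀`. -/
structure IsWeakSolADE {d : ℕ} (T ν : ℝ) (u : ℝ → Torus d → EuclideanSpace ℝ (Fin d))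
    (f₀ : Torus d → ℝ) (f : ℝ → Torus d → ℝ) : Prop where
  mem : MemMixed T 1 1 f
  mem_flux : MemMixed T 1 1 (fun t x => f t x • u t x)
  mem_init : MemLp f₀ 1 volume
  weak_eq : ∀ φ : ℝ → Torus d → ℝ, IsTestHalfOpen T φ →
    ∫ z, f z.1 z.2 * (timeDeriv φ z.1 z.2 + inner ℝ (u z.1 z.2) (grad (φ z.1) z.2)
        + ν * laplacian (φ z.1) z.2) ∂(spaceTime d T)
      = - ∫ x, f₀ x * φ 0 x

/-- Renormalised weak solutions of the transport equation. -/
def IsRenormalised {d : ℕ} (T : ℝ) (u : ℝ → Torus d → EuclideanSpace ℝ (Fin d))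
    (f₀ : Torus d → ℝ) (f : ℝ → Torus d → ℝ) : Prop :=
  IsWeakSolTE T u f₀ f ∧
    ∀ β : ℝ →ᵇ ℝ, IsWeakSolTE T u (fun x => β (f₀ x)) (fun t x => β (f t x))

/-- `f` is the unique weak solution of the transport equation in the class `L^∞ L^∞`. -/
def IsUniqueBoundedSolTE {d : ℕ} (T : ℝ) (u : ℝ → Torus d → EuclideanSpace ℝ (Fin d))
    (f₀ : Torus d → ℝ) (f : ℝ → Torus d → ℝ) : Prop :=
  MemMixed T ∞ ∞ f ∧ IsWeakSolTE T u f₀ f ∧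
    ∀ g : ℝ → Torus d → ℝ, MemMixed T ∞ ∞ g → IsWeakSolTE T u f₀ g →
      ∀ᵐ z ∂(spaceTime d T), g z.1 z.2 = f z.1 z.2

/-- The curves `t ↦ f(·,t)` and `t ↦ g(·,t)` agree, as function classes on `𝕋^d`, for
almost every `t ∈ [0,T]`. -/
def IsRepresentative {d : ℕ} (T : ℝ) (f g : ℝ → Torus d → ℝ) : Prop :=
  ∀ᵐ t ∂(timeMeasure T), f t =ᵐ[volume] g t

/-- `t ↦ g(·,t)` is a curve `[0,T] → L^∞(𝕋^d)` continuous for the weak-* topology. -/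
def WeakStarContinuous {d : ℕ} (T : ℝ) (g : ℝ → Torus d → ℝ) : Prop :=
  (∀ t ∈ Icc 0 T, MemLp (g t) ∞ volume) ∧
    ∀ h : Torus d → ℝ, MemLp h 1 volume →
      ContinuousOn (fun t => ∫ x, g t x * h x) (Icc 0 T)

/-- `‖g(·,t)‖_{L^p} ≤ ‖f₀‖_{L^p}` for all `t ∈ [0,T]` and all `p ∈ [1,∞]`. -/
def InitialLpInequality {d : ℕ} (T : ℝ) (f₀ : Torus d → ℝ) (g : ℝ → Torus d → ℝ) : Prop :=
  ∀ p : ℝ≥0∞, 1 ≤ p → ∀ t ∈ Icc 0 T, eLpNorm (g t) p volume ≤ eLpNorm f₀ p volume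

/-- `t ↦ g(·,t)` is a norm-continuous curve `[0,T] → L^1(𝕋^d)`. -/
def StrongL1Continuous {d : ℕ} (T : ℝ) (g : ℝ → Torus d → ℝ) : Prop :=
  (∀ t ∈ Icc 0 T, MemLp (g t) 1 volume) ∧
    ∀ s ∈ Icc 0 T,
      Tendsto (fun t => eLpNorm (fun x => g t x - g s x) 1 volume) (𝓝[Icc 0 T] s) (𝓝 0)

/-- `f ∈ C^0([0,T]; L^1(𝕋^d))`, as a function class on space-time. -/
def MemC0L1 {d : ℕ} (T : ℝ) (f : ℝ → Torus d → ℝ) : Prop :=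
  ∃ g, IsRepresentative T f g ∧ StrongL1Continuous T g

/-- `F ν → f` as `ν → 0⁺` in the weak-* topology of `L^∞ L^∞ = (L^1 L^1)^*`. -/
def TendstoWeakStar {d : ℕ} (T : ℝ) (F : ℝ → ℝ → Torus d → ℝ) (f : ℝ → Torus d → ℝ) : Prop :=
  (∀ ν > 0, MemMixed T ∞ ∞ (F ν)) ∧ MemMixed T ∞ ∞ f ∧
    ∀ g : ℝ → Torus d → ℝ, MemMixed T 1 1 g →
      Tendsto (fun ν => ∫ z, F ν z.1 z.2 * g z.1 z.2 ∂(spaceTime d T)) (𝓝[>] 0)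
        (𝓝 (∫ z, f z.1 z.2 * g z.1 z.2 ∂(spaceTime d T)))

/-- `F ν → f` as `ν → 0⁺` in the norm of `L^p L^q`. -/
def TendstoMixed {d : ℕ} (T : ℝ) (p q : ℝ≥0∞) (F : ℝ → ℝ → Torus d → ℝ)
    (f : ℝ → Torus d → ℝ) : Prop :=
  (∀ ν > 0, MemMixed T p q (F ν)) ∧ MemMixed T p q f ∧
    Tendsto (fun ν => mixedNorm T p q (fun t x => F ν t x - f t x)) (𝓝[>] 0) (𝓝 0)

end

end VanishingViscosity

open VanishingViscosity

/-! The equation passes to weak-* limits, so by Banach–Alaoglu `f^ν` converges weak-* along every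
ultrafilter refining `ν → 0` to a bounded weak solution of the transport equation. Uniqueness
identifies each of these limits as `f`, hence the whole family converges.

Renormalisation with a bounded `β` that is the square on the range of `f` and `f₀` shows that
`‖f(t)‖_{L²} = ‖f₀‖_{L²}` for almost every `t`. Thus `‖f^ν(t)‖_{L²} ≤ ‖f(t)‖_{L²}`, that is
`∫ (f^ν - f)² ≤ -2 ∫ (f^ν - f) f`, and weak-* convergence upgrades to strong convergence in `L²`.
The uniform `L^∞` bound turns this into convergence in every `L^p` with `p < ∞`.

For convergence uniform in time, `{f(t) : t ∈ [0,T]}` is compact in `L¹`, so in the last inequality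
`f(t)` may be replaced by one of finitely many smooth `h`. Testing both equations with `h` gives
`|∫ (f^ν - f)(t) h| ≤ ∫∫ |f^ν - f| |u · ∇h| + ν ∫∫ |f^ν| |Δh|`, uniformly in `t`. Although `u` is
only integrable, the right-hand side tends to zero, because the bounded functions `|f^ν - f|` tend
to zero weak-*. -/

namespace VanishingViscosity

section BoundedFunctions

variable {α ι E : Type*} [MeasurableSpace α] {μ : Measure α} [NormedAddCommGroup E]

/-- `φ` belongs to the closed ball of radius `C` in `L^∞(μ)`. -/
structure AEBoundedBy (C : ℝ) (φ : α → E) (μ : Measure α) : Prop where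
  aestronglyMeasurable : AEStronglyMeasurable φ μ
  ae_norm_le : ∀ᵐ x ∂μ, ‖φ x‖ ≤ C

/-- `φ i → g` along `l` in the weak-* topology of `L^∞(μ) = L^1(μ)^*`. -/
def WeakStarTendsto (μ : Measure α) (φ : ι → α → ℝ) (l : Filter ι) (g : α → ℝ) : Prop :=
  ∀ h, Integrable h μ → Tendsto (fun i => ∫ x, φ i x * h x ∂μ) l (𝓝 (∫ x, g x * h x ∂μ))

namespace AEBoundedBy

variable {C D : ℝ} {φ ψ : α → E}

theorem memLp [IsFiniteMeasure μ] (hφ : AEBoundedBy C φ μ) (p : ℝ≥0∞) : MemLp φ p μ :=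
  .of_bound hφ.aestronglyMeasurable C hφ.ae_norm_le

theorem integrable [IsFiniteMeasure μ] (hφ : AEBoundedBy C φ μ) : Integrable φ μ :=
  .of_bound hφ.aestronglyMeasurable C hφ.ae_norm_le

theorem mono (hφ : AEBoundedBy C φ μ) (hCD : C ≤ D) : AEBoundedBy D φ μ :=
  ⟨hφ.aestronglyMeasurable, hφ.ae_norm_le.mono fun _ hx => hx.trans hCD⟩

theorem sub (hφ : AEBoundedBy C φ μ) (hψ : AEBoundedBy D ψ μ) :
    AEBoundedBy (C + D) (fun x => φ x - ψ x) μ := by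
  refine ⟨hφ.aestronglyMeasurable.sub hψ.aestronglyMeasurable, ?_⟩
  filter_upwards [hφ.ae_norm_le, hψ.ae_norm_le] with x hφx hψx
  exact (norm_sub_le _ _).trans (add_le_add hφx hψx)

theorem norm (hφ : AEBoundedBy C φ μ) : AEBoundedBy C (fun x => ‖φ x‖) μ :=
  ⟨hφ.aestronglyMeasurable.norm, by simpa only [norm_norm] using hφ.ae_norm_le⟩

theorem integrable_mul {φ k : α → ℝ} (hφ : AEBoundedBy C φ μ) (hk : Integrable k μ) :
    Integrable (fun x => φ x * k x) μ :=
  hk.bdd_mul hφ.aestronglyMeasurable hφ.ae_norm_le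

theorem abs_integral_mul_le {φ k : α → ℝ} (hφ : AEBoundedBy C φ μ) (hk : Integrable k μ) :
    |∫ x, φ x * k x ∂μ| ≤ C * ∫ x, |k x| ∂μ := by
  rw [← integral_const_mul, ← Real.norm_eq_abs]
  refine norm_integral_le_of_norm_le (hk.abs.const_mul C) ?_
  filter_upwards [hφ.ae_norm_le] with x hx
  rw [norm_mul]
  exact mul_le_mul_of_nonneg_right hx (norm_nonneg _)

theorem lipschitzWith_integral_mul {φ : α → ℝ} (hφ : AEBoundedBy C φ μ) :
    LipschitzWith C.toNNReal (fun v : α →₁[μ] ℝ => ∫ x, φ x * v x ∂μ) := by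
  refine LipschitzWith.of_dist_le' fun v w => ?_
  have hv := L1.integrable_coeFn v
  have hw := L1.integrable_coeFn w
  rw [Real.dist_eq, L1.dist_eq_integral_dist,
    ← integral_sub (hφ.integrable_mul hv) (hφ.integrable_mul hw)]
  simp only [← mul_sub, Real.dist_eq]
  exact hφ.abs_integral_mul_le (hv.sub hw)

end AEBoundedBy

theorem integral_mul_indicator_const (φ : α → ℝ) (c : ℝ) {A : Set α} (hA : MeasurableSet A) :
    ∫ x, φ x * A.indicator (fun _ => c) x ∂μ = (∫ x in A, φ x ∂μ) * c := by
  rw [← integral_mul_const, ← integral_indicator hA]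
  congr 1 with x
  by_cases hx : x ∈ A <;> simp [hx]

theorem weakStarTendsto_of_tendsto_setIntegral {l : Filter ι} {φ : ι → α → ℝ} {g : α → ℝ} {C : ℝ}
    (hφ : ∀ i, AEBoundedBy C (φ i) μ) (hg : AEBoundedBy C g μ)
    (hlim : ∀ A, MeasurableSet A → μ A < ∞ →
      Tendsto (fun i => ∫ x in A, φ i x ∂μ) l (𝓝 (∫ x in A, g x ∂μ))) :
    WeakStarTendsto μ φ l g := by
  refine Integrable.induction
    (P := fun h => Tendsto (fun i => ∫ x, φ i x * h x ∂μ) l (𝓝 (∫ x, g x * h x ∂μ)))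
    (fun c A hA hμA => ?_) (fun h k _ hh hk hh_lim hk_lim => ?_) ?_ fun h k hhk _ hh_lim => ?_
  · simp only [integral_mul_indicator_const _ c hA]
    exact (hlim A hA hμA).mul_const c
  · simp only [Pi.add_apply, mul_add]
    rw [integral_add (hg.integrable_mul hh) (hg.integrable_mul hk)]
    refine (hh_lim.add hk_lim).congr fun i => ?_
    rw [integral_add ((hφ i).integrable_mul hh) ((hφ i).integrable_mul hk)]
  · exact (LipschitzWith.uniformEquicontinuous _ _ fun i =>
      (hφ i).lipschitzWith_integral_mul).equicontinuous.isClosed_setOfPred_tendsto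
        hg.lipschitzWith_integral_mul.continuous
  · have hcongr (ψ : α → ℝ) : ∫ x, ψ x * h x ∂μ = ∫ x, ψ x * k x ∂μ :=
      integral_congr_ae (hhk.mono fun x hx => congrArg (ψ x * ·) hx)
    simpa only [hcongr] using hh_lim

theorem exists_tendsto_inner_of_norm_le {H : Type*} [NormedAddCommGroup H] [InnerProductSpace ℝ H]
    [CompleteSpace H] (U : Ultrafilter ι) {V : ι → H} {R : ℝ} (hV : ∀ i, ‖V i‖ ≤ R) :
    ∃ g : H, ∀ h, Tendsto (fun i => inner ℝ (V i) h) U (𝓝 (inner ℝ g h)) := by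
  let X (i : ι) : WeakDual ℝ H := StrongDual.toWeakDual (InnerProductSpace.toDual ℝ H (V i))
  have hX : (U.map X : Filter (WeakDual ℝ H)) ≤
      𝓟 (WeakDual.toStrongDual ⁻¹' Metric.closedBall 0 R) :=
    tendsto_principal.2 (Eventually.of_forall fun i => by simpa [X] using hV i)
  obtain ⟨ℓ, -, hℓ⟩ := (WeakDual.isCompact_closedBall 0 R).ultrafilter_le_nhds _ hX
  refine ⟨(InnerProductSpace.toDual ℝ H).symm (WeakDual.toStrongDual ℓ), fun h => ?_⟩
  rw [InnerProductSpace.toDual_symm_apply]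
  exact ((WeakDual.eval_continuous h).tendsto ℓ).comp hℓ

theorem aeBoundedBy_of_tendsto_setIntegral [IsFiniteMeasure μ] {l : Filter ι} [l.NeBot]
    {φ : ι → α → ℝ} {g : α → ℝ} {C : ℝ} (hφ : ∀ i, AEBoundedBy C (φ i) μ) (hg : Integrable g μ)
    (hlim : ∀ A, MeasurableSet A → Tendsto (fun i => ∫ x in A, φ i x ∂μ) l (𝓝 (∫ x in A, g x ∂μ))) :
    AEBoundedBy C g μ := by
  have hupper : g ≤ᵐ[μ] fun _ => C := by
    refine ae_le_of_forall_setIntegral_le hg (integrable_const C) fun A hA _ => ?_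
    refine le_of_tendsto' (hlim A hA) fun i => ?_
    exact setIntegral_mono_ae (hφ i).integrable.integrableOn (integrable_const C)
      ((hφ i).ae_norm_le.mono fun x hx => (abs_le.1 hx).2)
  have hlower : (fun _ => -C) ≤ᵐ[μ] g := by
    refine ae_le_of_forall_setIntegral_le (integrable_const (-C)) hg fun A hA _ => ?_
    refine ge_of_tendsto' (hlim A hA) fun i => ?_
    exact setIntegral_mono_ae (integrable_const (-C)) (hφ i).integrable.integrableOn
      ((hφ i).ae_norm_le.mono fun x hx => (abs_le.1 hx).1)
  exact ⟨hg.aestronglyMeasurable, by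
    filter_upwards [hlower, hupper] with x hxl hxu using abs_le.2 ⟨hxl, hxu⟩⟩

theorem exists_weakStarTendsto [IsFiniteMeasure μ] (U : Ultrafilter ι) {φ : ι → α → ℝ} {C : ℝ}
    (hφ : ∀ i, AEBoundedBy C (φ i) μ) :
    ∃ g, AEBoundedBy C g μ ∧ WeakStarTendsto μ φ U g := by
  let V (i : ι) : Lp ℝ 2 μ := ((hφ i).memLp 2).toLp (φ i)
  have hV (i : ι) : V i =ᵐ[μ] φ i := ((hφ i).memLp 2).coeFn_toLp
  have hVC (i : ι) : ‖V i‖ ≤ μ.real univ ^ (2 : ℝ≥0∞).toReal⁻¹ * |C| := by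
    refine Lp.norm_le_of_ae_bound (abs_nonneg C) ?_
    filter_upwards [(hφ i).ae_norm_le, hV i] with x hx hVx
    rw [hVx]
    exact hx.trans (le_abs_self C)
  obtain ⟨g, hg⟩ := exists_tendsto_inner_of_norm_le U hVC
  have hlim (A : Set α) (hA : MeasurableSet A) :
      Tendsto (fun i => ∫ x in A, φ i x ∂μ) U (𝓝 (∫ x in A, g x ∂μ)) := by
    have h := hg (indicatorConstLp 2 hA (measure_ne_top μ A) 1)
    simp only [real_inner_comm (indicatorConstLp 2 hA (measure_ne_top μ A) (1 : ℝ)),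
      L2.inner_indicatorConstLp_one] at h
    exact h.congr fun i => integral_congr_ae (ae_restrict_of_ae (hV i))
  have hgC := aeBoundedBy_of_tendsto_setIntegral hφ ((Lp.memLp g).integrable one_le_two) hlim
  exact ⟨g, hgC, weakStarTendsto_of_tendsto_setIntegral hφ hgC fun A hA _ => hlim A hA⟩

end BoundedFunctions

section Quadratic

variable {α ι : Type*} [MeasurableSpace α] {μ : Measure α}

theorem integral_sub_sq_le {a b : α → ℝ} (ha : MemLp a 2 μ) (hb : MemLp b 2 μ)
    (hab : ∫ x, a x ^ 2 ∂μ ≤ ∫ x, b x ^ 2 ∂μ) :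
    ∫ x, (a x - b x) ^ 2 ∂μ ≤ -2 * ∫ x, (a x - b x) * b x ∂μ := by
  have hmul : Integrable (fun x => (a x - b x) * b x) μ := (ha.sub hb).integrable_mul hb
  have hsq : Integrable (fun x => a x ^ 2 - b x ^ 2) μ := ha.integrable_sq.sub hb.integrable_sq
  calc ∫ x, (a x - b x) ^ 2 ∂μ
      = ∫ x, (a x ^ 2 - b x ^ 2 + -2 * ((a x - b x) * b x)) ∂μ := by
        congr 1 with x
        ring
    _ = (∫ x, a x ^ 2 ∂μ) - (∫ x, b x ^ 2 ∂μ) + -2 * ∫ x, (a x - b x) * b x ∂μ := by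
        rw [integral_add hsq (hmul.const_mul _),
          integral_sub ha.integrable_sq hb.integrable_sq, integral_const_mul]
    _ ≤ -2 * ∫ x, (a x - b x) * b x ∂μ := by linarith

theorem integral_sq_le_of_eLpNorm_le {a b : α → ℝ} (ha : MemLp a 2 μ) (hb : MemLp b 2 μ)
    (hab : eLpNorm a 2 μ ≤ eLpNorm b 2 μ) : ∫ x, a x ^ 2 ∂μ ≤ ∫ x, b x ^ 2 ∂μ := by
  rw [ha.eLpNorm_eq_integral_rpow_norm two_ne_zero ENNReal.ofNat_ne_top,
    hb.eLpNorm_eq_integral_rpow_norm two_ne_zero ENNReal.ofNat_ne_top,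
    ENNReal.ofReal_le_ofReal_iff (by positivity),
    Real.rpow_le_rpow_iff (by positivity) (by positivity) (by norm_num)] at hab
  simpa only [ENNReal.toReal_ofNat, Real.rpow_ofNat, Real.norm_eq_abs, sq_abs] using hab

theorem integral_abs_le_sqrt_mul_sqrt [IsFiniteMeasure μ] {w : α → ℝ} (hw : MemLp w 2 μ) :
    ∫ x, |w x| ∂μ ≤ √(μ.real univ) * √(∫ x, w x ^ 2 ∂μ) := by
  have := integral_mul_norm_le_Lp_mul_Lq (μ := μ) (f := fun _ => (1 : ℝ)) (g := w)
    Real.HolderConjugate.two_two (memLp_const 1) (by simpa using hw)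
  simpa [Real.sqrt_eq_rpow] using this

variable {l : Filter ι} {φ : ι → α → ℝ} {g : α → ℝ} {C D : ℝ}

theorem WeakStarTendsto.tendsto_integral_sub_sq [IsFiniteMeasure μ] (hφg : WeakStarTendsto μ φ l g)
    (hφ : ∀ i, AEBoundedBy C (φ i) μ) (hg : AEBoundedBy D g μ)
    (hle : ∀ i, ∫ x, φ i x ^ 2 ∂μ ≤ ∫ x, g x ^ 2 ∂μ) :
    Tendsto (fun i => ∫ x, (φ i x - g x) ^ 2 ∂μ) l (𝓝 0) := by
  have hlim : Tendsto (fun i => -2 * ∫ x, (φ i x - g x) * g x ∂μ) l (𝓝 0) := by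
    have h := ((hφg g hg.integrable).sub_const (∫ x, g x * g x ∂μ)).const_mul (-2)
    rw [sub_self, mul_zero] at h
    refine h.congr fun i => ?_
    simp only [sub_mul]
    rw [integral_sub ((hφ i).integrable_mul hg.integrable) (hg.integrable_mul hg.integrable)]
  exact squeeze_zero (fun i => integral_nonneg fun x => sq_nonneg _)
    (fun i => integral_sub_sq_le ((hφ i).memLp 2) (hg.memLp 2) (hle i)) hlim

theorem weakStarTendsto_abs_zero [IsFiniteMeasure μ] (hφ : ∀ i, AEBoundedBy C (φ i) μ)
    (hlim : Tendsto (fun i => ∫ x, φ i x ^ 2 ∂μ) l (𝓝 0)) :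
    WeakStarTendsto μ (fun i x => |φ i x|) l 0 := by
  have hsqrt : Tendsto (fun i => √(μ.real univ) * √(∫ x, φ i x ^ 2 ∂μ)) l (𝓝 0) := by
    simpa using hlim.sqrt.const_mul √(μ.real univ)
  have hzero : AEBoundedBy |C| (0 : α → ℝ) μ := ⟨aestronglyMeasurable_const, by simp⟩
  refine weakStarTendsto_of_tendsto_setIntegral (fun i => ((hφ i).mono (le_abs_self C)).norm) hzero
    fun A _ _ => ?_
  simp only [Pi.zero_apply, integral_zero]
  refine squeeze_zero (fun i => integral_nonneg fun x => abs_nonneg _) (fun i => ?_) hsqrt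
  exact (setIntegral_le_integral (hφ i).integrable.abs
    (ae_of_all _ fun x => abs_nonneg _)).trans (integral_abs_le_sqrt_mul_sqrt ((hφ i).memLp 2))

theorem AEBoundedBy.eLpNorm_rpow_le {E : Type*} [NormedAddCommGroup E] {φ : α → E}
    (hφ : AEBoundedBy C φ μ) {p : ℝ≥0∞} (hp1 : 1 ≤ p) (hp : p ≠ ∞) :
    eLpNorm φ p μ ^ p.toReal ≤ ENNReal.ofReal C ^ (p.toReal - 1) * eLpNorm φ 1 μ := by
  have hp0 : p ≠ 0 := (zero_lt_one.trans_le hp1).ne'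
  have hr : 0 ≤ p.toReal - 1 := by
    simpa using (ENNReal.toReal_le_toReal ENNReal.one_ne_top hp).2 hp1
  rw [eLpNorm_eq_lintegral_rpow_enorm_toReal hp0 hp, ← ENNReal.rpow_mul,
    one_div_mul_cancel (ENNReal.toReal_pos hp0 hp).ne', ENNReal.rpow_one,
    eLpNorm_one_eq_lintegral_enorm, ← lintegral_const_mul'' _ hφ.aestronglyMeasurable.enorm]
  refine lintegral_mono_ae ?_
  filter_upwards [hφ.ae_norm_le] with x hx
  have hxC : ‖φ x‖ₑ ≤ ENNReal.ofReal C := by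
    rw [← ofReal_norm]
    exact ENNReal.ofReal_le_ofReal hx
  calc ‖φ x‖ₑ ^ p.toReal = ‖φ x‖ₑ ^ (p.toReal - 1) * ‖φ x‖ₑ := by
        conv_lhs => rw [← sub_add_cancel p.toReal 1]
        rw [ENNReal.rpow_add_of_nonneg _ _ hr zero_le_one, ENNReal.rpow_one]
    _ ≤ ENNReal.ofReal C ^ (p.toReal - 1) * ‖φ x‖ₑ := by gcongr

theorem exists_pos_forall_eLpNorm_le (μ : Measure α) [IsFiniteMeasure μ] (C : ℝ) {p ε : ℝ≥0∞}
    (hp1 : 1 ≤ p) (hp : p ≠ ∞) (hε : 0 < ε) :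
    ∃ δ > 0, ∀ w : α → ℝ, AEBoundedBy C w μ → ∫ x, w x ^ 2 ∂μ ≤ δ → eLpNorm w p μ ≤ ε := by
  have hp_pos : 0 < p.toReal := ENNReal.toReal_pos (zero_lt_one.trans_le hp1).ne' hp
  have hr : 0 ≤ p.toReal - 1 := by
    simpa using (ENNReal.toReal_le_toReal ENNReal.one_ne_top hp).2 hp1
  have hsqrt : Tendsto (fun δ : ℝ => ENNReal.ofReal (√(μ.real univ) * √δ)) (𝓝[>] 0) (𝓝 0) := by
    have hcont : Continuous fun δ : ℝ => ENNReal.ofReal (√(μ.real univ) * √δ) :=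
      ENNReal.continuous_ofReal.comp (by fun_prop)
    simpa using (hcont.tendsto 0).mono_left nhdsWithin_le_nhds
  have hlim : Tendsto (fun δ : ℝ => ENNReal.ofReal C ^ (p.toReal - 1) *
      ENNReal.ofReal (√(μ.real univ) * √δ)) (𝓝[>] 0) (𝓝 0) := by
    simpa using ENNReal.Tendsto.const_mul hsqrt
      (.inr (ENNReal.rpow_ne_top_of_nonneg hr ENNReal.ofReal_ne_top))
  have hεp : 0 < ε ^ p.toReal := ENNReal.rpow_pos_of_nonneg hε hp_pos.le
  obtain ⟨δ, hδε, hδ⟩ :=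
    ((hlim.eventually (gt_mem_nhds hεp)).and self_mem_nhdsWithin).exists
  refine ⟨δ, hδ, fun w hw hwδ => ?_⟩
  rw [← ENNReal.rpow_le_rpow_iff hp_pos]
  refine (hw.eLpNorm_rpow_le hp1 hp).trans (le_trans ?_ hδε.le)
  gcongr
  rw [eLpNorm_one_eq_lintegral_enorm, ← ofReal_integral_norm_eq_lintegral_enorm hw.integrable]
  refine ENNReal.ofReal_le_ofReal ((integral_abs_le_sqrt_mul_sqrt (hw.memLp 2)).trans ?_)
  gcongr

end Quadratic

section WeakDerivative

theorem exists_forall_ge_eq_zero {T : ℝ} {ψ : ℝ → ℝ} (hψ : HasCompactSupport ψ)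
    (hψT : tsupport ψ ⊆ Iio T) : ∃ b < T, ∀ t, b ≤ t → ψ t = 0 := by
  obtain ⟨b, hb, hbT⟩ : ∃ b < T, ∀ t ∈ tsupport ψ, t ≤ b := by
    rcases (tsupport ψ).eq_empty_or_nonempty with he | hne
    · exact ⟨T - 1, by linarith, by simp [he]⟩
    · obtain ⟨b, hb, hmax⟩ := (HasCompactSupport.isCompact hψ).exists_isGreatest hne
      exact ⟨b, hψT hb, hmax⟩
  obtain ⟨b', hbb', hb'T⟩ := exists_between hb
  exact ⟨b', hb'T, fun t ht => image_eq_zero_of_notMem_tsupport fun h =>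
    (hbT t h).not_gt (hbb'.trans_le ht)⟩

theorem exists_contDiff_deriv_eq {T : ℝ} {ψ : ℝ → ℝ} (hψ : ContDiff ℝ (⊤ : ℕ∞) ψ)
    (hψ_supp : HasCompactSupport ψ) (hψT : tsupport ψ ⊆ Iio T) :
    ∃ η : ℝ → ℝ, ContDiff ℝ (⊤ : ℕ∞) η ∧ deriv η = ψ ∧ ∃ b < T, ∀ t, b ≤ t → η t = 0 := by
  have hη (t : ℝ) : HasDerivAt (fun t => ∫ s in T..t, ψ s) (ψ t) t :=
    intervalIntegral.integral_hasDerivAt_right (hψ.continuous.intervalIntegrable _ _)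
      (hψ.continuous.stronglyMeasurableAtFilter _ _) hψ.continuous.continuousAt
  have hderiv : deriv (fun t => ∫ s in T..t, ψ s) = ψ := funext fun t => (hη t).deriv
  obtain ⟨b, hbT, hb⟩ := exists_forall_ge_eq_zero hψ_supp hψT
  refine ⟨_, contDiff_infty_iff_deriv.2 ⟨fun t => (hη t).differentiableAt, hderiv.symm ▸ hψ⟩,
    hderiv, b, hbT, fun t ht => intervalIntegral.integral_zero_ae (.of_forall fun s hs => ?_)⟩
  exact hb s ((le_min hbT.le ht).trans hs.1.le)

theorem integral_mul_eq_neg_integral_primitive_mul_deriv {a b : ℝ} {k η : ℝ → ℝ}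
    (hk : IntervalIntegrable k volume a b) (hη : ContDiff ℝ 1 η) (hηb : η b = 0) :
    ∫ t in a..b, k t * η t = -∫ t in a..b, (∫ s in a..t, k s) * deriv η t := by
  have hparts := (hk.absolutelyContinuousOnInterval_intervalIntegral
    left_mem_uIcc).integral_mul_deriv_eq_deriv_mul hη.contDiffOn.absolutelyContinuousOnInterval
  rw [hηb, intervalIntegral.integral_same, mul_zero, zero_mul, sub_zero, zero_sub] at hparts
  rw [hparts, neg_neg]
  refine intervalIntegral.integral_congr_ae ?_
  filter_upwards [hk.ae_hasDerivAt_integral] with t ht hmem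
  rw [(ht (uIoc_subset_uIcc hmem) a left_mem_uIcc).deriv]

theorem integral_mul_sub_primitive_eq_zero {T c : ℝ} {w k ψ η : ℝ → ℝ}
    (hw : IntervalIntegrable w volume 0 T) (hk : IntervalIntegrable k volume 0 T)
    (hη : ContDiff ℝ (⊤ : ℕ∞) η) (hηψ : deriv η = ψ) (hηT : η T = 0)
    (hweak : ∫ t in 0..T, (w t * ψ t + k t * η t) = -(c * η 0)) :
    ∫ t in 0..T, ψ t * (w t - (∫ s in 0..t, k s) - c) = 0 := by
  have hη1 : ContDiff ℝ 1 η := hη.of_le (by exact_mod_cast le_top)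
  have hψ : Continuous ψ := hηψ ▸ hη1.continuous_deriv le_rfl
  have hK : ContinuousOn (fun t => ∫ s in 0..t, k s) (uIcc 0 T) :=
    (hk.absolutelyContinuousOnInterval_intervalIntegral left_mem_uIcc).continuousOn
  have hwψ : IntervalIntegrable (fun t => w t * ψ t) volume 0 T :=
    hw.mul_continuousOn hψ.continuousOn
  have hKψ : IntervalIntegrable (fun t => (∫ s in 0..t, k s) * ψ t) volume 0 T :=
    (hK.mul hψ.continuousOn).intervalIntegrable
  have hψint : ∫ t in 0..T, ψ t = -η 0 := by
    rw [← hηψ, intervalIntegral.integral_deriv_eq_sub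
      (fun t _ => (hη1.differentiable one_ne_zero).differentiableAt)
      (hηψ ▸ hψ.intervalIntegrable _ _), hηT, zero_sub]
  have hkη := integral_mul_eq_neg_integral_primitive_mul_deriv hk hη1 hηT
  rw [intervalIntegral.integral_add hwψ (hk.mul_continuousOn hη.continuous.continuousOn), hkη,
    hηψ] at hweak
  calc ∫ t in 0..T, ψ t * (w t - (∫ s in 0..t, k s) - c)
      = ∫ t in 0..T, (w t * ψ t - (∫ s in 0..t, k s) * ψ t - c * ψ t) := by
        congr 1 with t
        ring
    _ = (∫ t in 0..T, w t * ψ t) - (∫ t in 0..T, (∫ s in 0..t, k s) * ψ t) - c * -η 0 := by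
        rw [intervalIntegral.integral_sub (hwψ.sub hKψ) ((hψ.intervalIntegrable _ _).const_mul c),
          intervalIntegral.integral_sub hwψ hKψ, intervalIntegral.integral_const_mul, hψint]
    _ = 0 := by linarith

theorem ae_eq_add_intervalIntegral_of_weak {T c : ℝ} {w k : ℝ → ℝ}
    (hw : Integrable w (timeMeasure T)) (hk : Integrable k (timeMeasure T))
    (hweak : ∀ η, ContDiff ℝ (⊤ : ℕ∞) η → (∃ b < T, ∀ t, b ≤ t → η t = 0) →
      ∫ t, (w t * deriv η t + k t * η t) ∂timeMeasure T = -(c * η 0)) :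
    ∀ᵐ t ∂timeMeasure T, w t = c + ∫ s in 0..t, k s := by
  rcases le_or_gt T 0 with hT | hT
  · simp [timeMeasure, Measure.restrict_eq_zero.2, hT]
  have hiff {g : ℝ → ℝ} : IntervalIntegrable g volume 0 T ↔ Integrable g (timeMeasure T) :=
    intervalIntegrable_iff_integrableOn_Icc_of_le hT.le
  let K (t : ℝ) : ℝ := ∫ s in 0..t, k s
  have hK : IntervalIntegrable K volume 0 T :=
    ((hiff.2 hk).absolutelyContinuousOnInterval_intervalIntegral
      left_mem_uIcc).continuousOn.intervalIntegrable
  have hdiff : IntegrableOn (fun t => w t - K t - c) (Ioo 0 T) :=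
    (hiff.1 (((hiff.2 hw).sub hK).sub intervalIntegrable_const)).mono_measure
      (Measure.restrict_mono_set _ Ioo_subset_Icc_self)
  have hzero : ∀ᵐ t, t ∈ Ioo 0 T → w t - K t - c = 0 := by
    refine isOpen_Ioo.ae_eq_zero_of_integral_contDiff_smul_eq_zero hdiff.locallyIntegrableOn
      fun ψ hψ hψ_supp hψT => ?_
    obtain ⟨η, hη, hηψ, b, hbT, hηb⟩ :=
      exists_contDiff_deriv_eq hψ hψ_supp (hψT.trans Ioo_subset_Iio_self)
    have hη_weak := hweak η hη ⟨b, hbT, hηb⟩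
    rw [hηψ, integral_Icc_eq_integral_Ioc, ← intervalIntegral.integral_of_le hT.le] at hη_weak
    rw [← intervalIntegral.integral_eq_integral_of_support_subset (a := 0) (b := T) fun t ht =>
      Ioo_subset_Ioc_self (hψT (subset_tsupport ψ fun h => ht (by simp [h])))]
    exact integral_mul_sub_primitive_eq_zero (hiff.2 hw) (hiff.2 hk) hη hηψ (hηb T hbT.le) hη_weak
  rw [timeMeasure, ← Measure.restrict_congr_set Ioo_ae_eq_Icc, ae_restrict_iff' measurableSet_Ioo]
  filter_upwards [hzero] with t ht hmem
  linarith [ht hmem]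

end WeakDerivative

section Torus

variable {d : ℕ} {φ : ℝ → Torus d → ℝ} {h : Torus d → ℝ}

instance : IsProbabilityMeasure (volume : Measure UnitAddCircle) := ⟨UnitAddCircle.measure_univ⟩

/-- The covering map `ℝ × ℝ^d → ℝ × 𝕋^d` along which `IsSmooth` lifts functions. -/
def cover (d : ℕ) (z : ℝ × (Fin d → ℝ)) : ℝ × Torus d :=
  (z.1, fun i => (z.2 i : UnitAddCircle))

theorem isOpenQuotientMap_cover (d : ℕ) : IsOpenQuotientMap (cover d) :=
  .prodMap .id (.piMap fun _ => QuotientAddGroup.isOpenQuotientMap_mk)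

theorem IsSmooth.continuous (hφ : IsSmooth φ) : Continuous fun z : ℝ × Torus d => φ z.1 z.2 :=
  (isOpenQuotientMap_cover d).isQuotientMap.continuous_iff.2 (ContDiff.continuous hφ)

theorem IsSmooth.continuous_slice (hφ : IsSmooth φ) (t : ℝ) : Continuous (φ t) :=
  hφ.continuous.comp (Continuous.prodMk_right t)

theorem IsSmooth.integrable_slice (hφ : IsSmooth φ) (t : ℝ) : Integrable (φ t) volume :=
  (hφ.continuous_slice t).integrable_of_hasCompactSupport (.of_compactSpace _)

theorem coe_add_single (y : Fin d → ℝ) (i : Fin d) (s : ℝ) :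
    ((fun j => (y j : UnitAddCircle)) + Pi.single i (s : UnitAddCircle) : Torus d) =
      fun j => ((y + s • Pi.single i (1 : ℝ) : Fin d → ℝ) j : UnitAddCircle) := by
  ext j
  rcases eq_or_ne j i with rfl | hji <;> simp [*]

theorem IsSmooth.of_eq_fderiv {χ : ℝ → Torus d → ℝ} (hφ : IsSmooth φ) (v : ℝ × (Fin d → ℝ))
    (hχ : ∀ z : ℝ × (Fin d → ℝ), χ z.1 (fun i => (z.2 i : UnitAddCircle)) =
      fderiv ℝ (fun z : ℝ × (Fin d → ℝ) => φ z.1 fun i => (z.2 i : UnitAddCircle)) z v) :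
    IsSmooth χ := by
  rw [IsSmooth, funext hχ]
  exact (ContDiff.fderiv_right hφ (by simp)).clm_apply contDiff_const

protected theorem IsSmooth.partialDeriv (hφ : IsSmooth φ) (i : Fin d) :
    IsSmooth fun t => partialDeriv i (φ t) := by
  refine hφ.of_eq_fderiv (0, Pi.single i 1) fun z => ?_
  have hline := (ContDiff.differentiable hφ (by simp) z).hasFDerivAt.hasLineDerivAt
    (0, Pi.single i 1)
  rw [← hline.lineDeriv]
  simp only [partialDeriv, lineDeriv, coe_add_single, Prod.smul_mk, Prod.fst_add, Prod.snd_add,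
    smul_zero, add_zero]

protected theorem IsSmooth.timeDeriv (hφ : IsSmooth φ) : IsSmooth (timeDeriv φ) := by
  refine hφ.of_eq_fderiv (1, 0) fun z => ?_
  have hline : HasDerivAt (fun s : ℝ => (s, z.2)) ((1 : ℝ), (0 : Fin d → ℝ)) z.1 :=
    (hasDerivAt_id z.1).prodMk (hasDerivAt_const z.1 z.2)
  have hfderiv := (ContDiff.differentiable hφ (by simp) (z.1, z.2)).hasFDerivAt
  exact (hfderiv.comp_hasDerivAt z.1 hline).deriv

protected theorem IsSmooth.laplacian (hφ : IsSmooth φ) : IsSmooth fun t => laplacian (φ t) :=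
  ContDiff.sum fun i _ => (hφ.partialDeriv i).partialDeriv i

theorem IsSmooth.continuous_grad (hφ : IsSmooth φ) :
    Continuous fun z : ℝ × Torus d => grad (φ z.1) z.2 :=
  (PiLp.continuous_toLp 2 _).comp (continuous_pi fun i => (hφ.partialDeriv i).continuous)

theorem isSmooth_mul {η : ℝ → ℝ} (hη : ContDiff ℝ (⊤ : ℕ∞) η) (hh : IsSmooth fun _ : ℝ => h) :
    IsSmooth fun t x => η t * h x :=
  (hη.comp contDiff_fst).mul hh

theorem partialDeriv_const_mul (i : Fin d) (c : ℝ) (h : Torus d → ℝ) :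
    partialDeriv i (fun x => c * h x) = fun x => c * partialDeriv i h x := by
  ext x
  simp only [partialDeriv, deriv_const_mul_field]

theorem grad_const_mul (c : ℝ) (h : Torus d → ℝ) (x : Torus d) :
    grad (fun x => c * h x) x = c • grad h x := by
  simp only [grad, partialDeriv_const_mul]
  rfl

theorem laplacian_const_mul (c : ℝ) (h : Torus d → ℝ) (x : Torus d) :
    laplacian (fun x => c * h x) x = c * laplacian h x := by
  simp only [laplacian, partialDeriv_const_mul, Finset.mul_sum]

theorem timeDeriv_mul (η : ℝ → ℝ) (h : Torus d → ℝ) (t : ℝ) (x : Torus d) :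
    timeDeriv (fun t x => η t * h x) t x = deriv η t * h x := by
  simp only [timeDeriv, deriv_mul_const_field]

theorem isSmooth_re_mul_mFourier (c : ℂ) (n : Fin d → ℤ) :
    IsSmooth fun (_ : ℝ) (x : Torus d) => (c * UnitAddTorus.mFourier n x).re := by
  have hlift : ContDiff ℝ (⊤ : ℕ∞) fun z : ℝ × (Fin d → ℝ) =>
      c * UnitAddTorus.mFourier n fun i => (z.2 i : UnitAddCircle) := by
    simp only [UnitAddTorus.mFourier, ContinuousMap.coe_mk, fourier_coe_apply]
    refine contDiff_const.mul (contDiff_prod fun i _ => ?_)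
    have hcoord : ContDiff ℝ (⊤ : ℕ∞) fun z : ℝ × (Fin d → ℝ) => ((z.2 i : ℝ) : ℂ) :=
      Complex.ofRealCLM.contDiff.comp (by fun_prop)
    fun_prop
  exact Complex.reCLM.contDiff.comp hlift

theorem isSmooth_re_of_mem_span {g : C(Torus d, ℂ)}
    (hg : g ∈ Submodule.span ℂ (range (UnitAddTorus.mFourier (d := Fin d)))) :
    IsSmooth fun (_ : ℝ) (x : Torus d) => (g x).re := by
  obtain ⟨c, rfl⟩ := Finsupp.mem_span_range_iff_exists_finsupp.1 hg
  simp only [Finsupp.sum, ContinuousMap.sum_apply, ContinuousMap.smul_apply, smul_eq_mul,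
    Complex.re_sum]
  exact ContDiff.sum fun n _ => isSmooth_re_mul_mFourier (c n) n

theorem exists_isSmooth_abs_sub_le {k : Torus d → ℝ} (hk : Continuous k) {ε : ℝ} (hε : 0 < ε) :
    ∃ h : Torus d → ℝ, IsSmooth (fun _ : ℝ => h) ∧ ∀ x, |k x - h x| ≤ ε := by
  let K : C(Torus d, ℂ) := ⟨fun x => (k x : ℂ), by fun_prop⟩
  have hK : K ∈
      (Submodule.span ℂ (range (UnitAddTorus.mFourier (d := Fin d)))).topologicalClosure :=
    UnitAddTorus.span_mFourier_closure_eq_top (d := Fin d) ▸ Submodule.mem_top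
  obtain ⟨L, hL, hKL⟩ := Metric.mem_closure_iff.1 hK ε hε
  refine ⟨fun x => (L x).re, isSmooth_re_of_mem_span hL, fun x => ?_⟩
  calc |k x - (L x).re| = |(K x - L x).re| := by simp [K]
    _ ≤ ‖K x - L x‖ := Complex.abs_re_le_norm _
    _ = dist (K x) (L x) := (dist_eq_norm _ _).symm
    _ ≤ ε := (ContinuousMap.dist_apply_le_dist x).trans hKL.le

theorem exists_isSmooth_integral_abs_sub_le {g : Torus d → ℝ} (hg : Integrable g volume)
    {ε : ℝ} (hε : 0 < ε) :
    ∃ h : Torus d → ℝ, IsSmooth (fun _ : ℝ => h) ∧ ∫ x, |g x - h x| ≤ ε := by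
  obtain ⟨k, hgk, hk⟩ := hg.exists_boundedContinuous_integral_sub_le (half_pos hε)
  obtain ⟨h, hh, hkh⟩ := exists_isSmooth_abs_sub_le k.continuous (half_pos hε)
  have hhi : Integrable h volume := hh.integrable_slice 0
  have hgk_norm : Integrable (fun x => ‖g x - k x‖) volume := (hg.sub hk).norm
  refine ⟨h, hh, ?_⟩
  calc ∫ x, |g x - h x| ≤ ∫ x, (‖g x - k x‖ + ε / 2) :=
        integral_mono (hg.sub hhi).abs (hgk_norm.add (integrable_const _)) fun x =>
          (abs_sub_le (g x) (k x) (h x)).trans (add_le_add_right (hkh x) _)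
    _ = (∫ x, ‖g x - k x‖) + ε / 2 := by
        rw [integral_add hgk_norm (integrable_const _)]
        simp
    _ ≤ ε := by linarith

end Torus

section MixedNorm

variable {d : ℕ} {E : Type*} [NormedAddCommGroup E] {T C : ℝ}

theorem aeBoundedBy_prod {α β : Type*} [MeasurableSpace α] [MeasurableSpace β] {μ : Measure α}
    {ν : Measure β} [SFinite ν] {φ : α × β → E} (hφ : AEStronglyMeasurable φ (μ.prod ν))
    (hC : ∀ᵐ a ∂μ, ∀ᵐ b ∂ν, ‖φ (a, b)‖ ≤ C) : AEBoundedBy C φ (μ.prod ν) := by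
  have hmk : ∀ᵐ z ∂μ.prod ν, ‖hφ.mk φ z‖ ≤ C := by
    refine (Measure.ae_prod_iff_ae_ae
      (hφ.stronglyMeasurable_mk.norm.measurable measurableSet_Iic)).2 ?_
    filter_upwards [hC, Measure.ae_ae_of_ae_prod hφ.ae_eq_mk] with a ha hmk
    filter_upwards [ha, hmk] with b hb hab
    rwa [← hab]
  refine ⟨hφ, ?_⟩
  filter_upwards [hmk, hφ.ae_eq_mk] with z hz hmk
  rwa [hmk]

theorem AEBoundedBy.ae_slice {α β : Type*} [MeasurableSpace α] [MeasurableSpace β] {μ : Measure α}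
    {ν : Measure β} [SFinite ν] {φ : α × β → E} (hφ : AEBoundedBy C φ (μ.prod ν)) :
    ∀ᵐ a ∂μ, AEBoundedBy C (fun b => φ (a, b)) ν := by
  filter_upwards [hφ.aestronglyMeasurable.prodMk_left, Measure.ae_ae_of_ae_prod hφ.ae_norm_le]
    with a hm hC using ⟨hm, hC⟩

theorem exists_aeBoundedBy_of_continuous {Φ : ℝ × Torus d → E} (T : ℝ) (hΦ : Continuous Φ) :
    ∃ B, AEBoundedBy B Φ (spaceTime d T) := by
  obtain ⟨B, hB⟩ := ((isCompact_Icc (a := (0 : ℝ)) (b := T)).prod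
    (isCompact_univ (X := Torus d))).exists_bound_of_continuousOn hΦ.continuousOn
  refine ⟨B, aeBoundedBy_prod hΦ.aestronglyMeasurable ?_⟩
  filter_upwards [ae_restrict_mem measurableSet_Icc] with t ht
  exact Eventually.of_forall fun x => hB (t, x) ⟨ht, mem_univ x⟩

theorem IsSmooth.exists_aeBoundedBy {φ : ℝ → Torus d → ℝ} (hφ : IsSmooth φ) (T : ℝ) :
    ∃ B, AEBoundedBy B (fun z : ℝ × Torus d => φ z.1 z.2) (spaceTime d T) :=
  exists_aeBoundedBy_of_continuous T hφ.continuous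

theorem mixedNorm_self {f : ℝ → Torus d → E}
    (hf : AEStronglyMeasurable (fun z : ℝ × Torus d => f z.1 z.2) (spaceTime d T))
    {p : ℝ≥0∞} (hp0 : p ≠ 0) (hp : p ≠ ∞) :
    mixedNorm T p p f = eLpNorm (fun z : ℝ × Torus d => f z.1 z.2) p (spaceTime d T) := by
  rw [mixedNorm, eLpNorm_eq_lintegral_rpow_enorm_toReal hp0 hp,
    eLpNorm_eq_lintegral_rpow_enorm_toReal hp0 hp, lintegral_prod _ (hf.enorm.pow_const _)]
  congr 2 with t
  rw [eLpNorm_eq_lintegral_rpow_enorm_toReal hp0 hp, enorm_eq_self, ← ENNReal.rpow_mul,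
    one_div_mul_cancel (ENNReal.toReal_pos hp0 hp).ne', ENNReal.rpow_one]

theorem memMixed_one_iff {f : ℝ → Torus d → E} :
    MemMixed T 1 1 f ↔ Integrable (fun z : ℝ × Torus d => f z.1 z.2) (spaceTime d T) := by
  rw [← memLp_one_iff_integrable, MemMixed, MemLp]
  exact and_congr_right fun hf => by rw [mixedNorm_self hf one_ne_zero ENNReal.one_ne_top]

theorem mixedNorm_top_le_iff {q c : ℝ≥0∞} {f : ℝ → Torus d → E} :
    mixedNorm T ∞ q f ≤ c ↔ ∀ᵐ t ∂timeMeasure T, eLpNorm (f t) q volume ≤ c := by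
  rw [mixedNorm, eLpNorm_exponent_top]
  refine ⟨fun h => ?_, fun h => eLpNormEssSup_le_of_ae_enorm_bound (by simpa using h)⟩
  filter_upwards [enorm_ae_le_eLpNormEssSup (fun t => eLpNorm (f t) q volume) (timeMeasure T)]
    with t ht using ht.trans h

theorem aeBoundedBy_of_eLpNorm_top_le {α : Type*} [MeasurableSpace α] {μ : Measure α} {φ : α → E}
    {c : ℝ≥0∞} (hφ : AEStronglyMeasurable φ μ) (hc : c ≠ ∞) (hφc : eLpNorm φ ∞ μ ≤ c) :
    AEBoundedBy c.toReal φ μ := by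
  refine ⟨hφ, ?_⟩
  rw [eLpNorm_exponent_top] at hφc
  filter_upwards [enorm_ae_le_eLpNormEssSup φ μ] with x hx
  rw [← toReal_enorm]
  exact ENNReal.toReal_mono hc (hx.trans hφc)

theorem aeBoundedBy_of_mixedNorm_le {f : ℝ → Torus d → E} {c : ℝ≥0∞}
    (hf : AEStronglyMeasurable (fun z : ℝ × Torus d => f z.1 z.2) (spaceTime d T))
    (hc : c ≠ ∞) (hfc : mixedNorm T ∞ ∞ f ≤ c) :
    AEBoundedBy c.toReal (fun z : ℝ × Torus d => f z.1 z.2) (spaceTime d T) := by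
  refine aeBoundedBy_prod hf ?_
  filter_upwards [hf.prodMk_left, mixedNorm_top_le_iff.1 hfc] with t hft htc
  exact (aeBoundedBy_of_eLpNorm_top_le hft hc htc).ae_norm_le

theorem AEBoundedBy.memMixed {f : ℝ → Torus d → E}
    (hf : AEBoundedBy C (fun z : ℝ × Torus d => f z.1 z.2) (spaceTime d T)) (p q : ℝ≥0∞) :
    MemMixed T p q f := by
  refine ⟨hf.aestronglyMeasurable, ?_⟩
  have hbound : ∀ᵐ t ∂timeMeasure T, ‖eLpNorm (f t) q volume‖ₑ ≤ ‖ENNReal.ofReal C‖ₑ := by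
    filter_upwards [hf.ae_slice] with t ht
    simpa using eLpNorm_le_of_ae_bound ht.ae_norm_le
  exact (eLpNorm_mono_enorm_ae hbound).trans_lt (memLp_const_enorm (by simp)).2

theorem spaceTime_mono {t : ℝ} (ht : t ≤ T) : spaceTime d t ≤ spaceTime d T :=
  Measure.prod_mono (Measure.restrict_mono_set _ (Icc_subset_Icc_right ht)) le_rfl

theorem ae_integral_slice_eq_of_weak {c : ℝ} {w k : ℝ × Torus d → ℝ}
    (hw : Integrable w (spaceTime d T)) (hk : Integrable k (spaceTime d T))
    (hweak : ∀ η : ℝ → ℝ, ContDiff ℝ (⊤ : ℕ∞) η → (∃ b < T, ∀ t, b ≤ t → η t = 0) →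
      ∫ z, (w z * deriv η z.1 + k z * η z.1) ∂spaceTime d T = -(c * η 0)) :
    ∀ᵐ t ∂timeMeasure T, ∫ x, w (t, x) = c + ∫ z, k z ∂spaceTime d t := by
  have hslice : ∀ᵐ t ∂timeMeasure T, ∫ x, w (t, x) = c + ∫ s in 0..t, ∫ x, k (s, x) := by
    refine ae_eq_add_intervalIntegral_of_weak hw.integral_prod_left hk.integral_prod_left
      fun η hη hηT => ?_
    have hmul {ζ : ℝ → ℝ} (hζ : Continuous ζ) {g : ℝ × Torus d → ℝ}
        (hg : Integrable g (spaceTime d T)) :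
        Integrable (fun z => g z * ζ z.1) (spaceTime d T) := by
      obtain ⟨B, hB⟩ := exists_aeBoundedBy_of_continuous (d := d) T (hζ.comp continuous_fst)
      exact hg.mul_bdd hB.aestronglyMeasurable hB.ae_norm_le
    have hwη := hmul (hη.continuous_deriv (by simp)) hw
    have hkη := hmul hη.continuous hk
    have hsum : Integrable (fun z => w z * deriv η z.1 + k z * η z.1) (spaceTime d T) := hwη.add hkη
    rw [← hweak η hη hηT, integral_prod _ hsum]
    refine integral_congr_ae ?_
    filter_upwards [hwη.prod_right_ae, hkη.prod_right_ae] with t hwt hkt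
    rw [← integral_mul_const, ← integral_mul_const, ← integral_add hwt hkt]
  filter_upwards [hslice, ae_restrict_mem measurableSet_Icc] with t ht htT
  rw [ht, integral_prod _ (hk.mono_measure (spaceTime_mono htT.2)),
    integral_Icc_eq_integral_Ioc, ← intervalIntegral.integral_of_le htT.1]

end MixedNorm

section VanishingViscosityLimit

variable {d : ℕ} {T : ℝ} {u : ℝ → Torus d → EuclideanSpace ℝ (Fin d)} {φ : ℝ → Torus d → ℝ}

theorem integrable_inner_grad (hu : MemMixed T 1 1 u) (hφ : IsSmooth φ) :
    Integrable (fun z : ℝ × Torus d => inner ℝ (u z.1 z.2) (grad (φ z.1) z.2)) (spaceTime d T) := by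
  have hu_int := memMixed_one_iff.1 hu
  obtain ⟨B, hB⟩ := exists_aeBoundedBy_of_continuous T hφ.continuous_grad
  refine (hu_int.norm.mul_const B).mono'
    (hu_int.aestronglyMeasurable.inner hB.aestronglyMeasurable) ?_
  filter_upwards [hB.ae_norm_le] with z hz
  exact (norm_inner_le_norm _ _).trans (mul_le_mul_of_nonneg_left hz (norm_nonneg _))

theorem integrable_transport (hu : MemMixed T 1 1 u) (hφ : IsSmooth φ) :
    Integrable (fun z : ℝ × Torus d =>
      timeDeriv φ z.1 z.2 + inner ℝ (u z.1 z.2) (grad (φ z.1) z.2)) (spaceTime d T) := by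
  obtain ⟨B, hB⟩ := hφ.timeDeriv.exists_aeBoundedBy T
  exact hB.integrable.add (integrable_inner_grad hu hφ)

theorem integrable_laplacian (hφ : IsSmooth φ) :
    Integrable (fun z : ℝ × Torus d => laplacian (φ z.1) z.2) (spaceTime d T) := by
  obtain ⟨B, hB⟩ := hφ.laplacian.exists_aeBoundedBy T
  exact hB.integrable

theorem IsWeakSolADE.integral_transport_eq {ν C : ℝ} {f₀ : Torus d → ℝ} {f : ℝ → Torus d → ℝ}
    (hf : IsWeakSolADE T ν u f₀ f) (hu : MemMixed T 1 1 u)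
    (hfC : AEBoundedBy C (fun z : ℝ × Torus d => f z.1 z.2) (spaceTime d T))
    (hφ : IsTestHalfOpen T φ) :
    ∫ z, f z.1 z.2 * (timeDeriv φ z.1 z.2 + inner ℝ (u z.1 z.2) (grad (φ z.1) z.2))
        ∂spaceTime d T
      = -(∫ x, f₀ x * φ 0 x) - ν * ∫ z, f z.1 z.2 * laplacian (φ z.1) z.2 ∂spaceTime d T := by
  have htransport := hfC.integrable_mul (integrable_transport hu hφ.1)
  have hlap := (hfC.integrable_mul (integrable_laplacian hφ.1)).const_mul ν
  rw [← hf.weak_eq φ hφ, eq_sub_iff_add_eq, ← integral_const_mul, ← integral_add htransport hlap]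
  congr 1 with z
  ring

variable {ι : Type*} {l : Filter ι} {ν : ι → ℝ} {f₀ : Torus d → ℝ} {F : ι → ℝ → Torus d → ℝ}
  {f g : ℝ → Torus d → ℝ} {C D : ℝ}

theorem isWeakSolTE_of_weakStarTendsto [l.NeBot] (hν : Tendsto ν l (𝓝 0)) (hu : MemMixed T 1 1 u)
    (hF : ∀ i, IsWeakSolADE T (ν i) u f₀ (F i))
    (hFC : ∀ i, AEBoundedBy C (fun z : ℝ × Torus d => F i z.1 z.2) (spaceTime d T))
    (hgD : AEBoundedBy D (fun z : ℝ × Torus d => g z.1 z.2) (spaceTime d T))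
    (hFg : WeakStarTendsto (spaceTime d T) (fun i z => F i z.1 z.2) l fun z => g z.1 z.2) :
    IsWeakSolTE T u f₀ g where
  mem := hgD.memMixed 1 1
  mem_flux := memMixed_one_iff.2 <|
    (memMixed_one_iff.1 hu).bdd_smul D hgD.aestronglyMeasurable hgD.ae_norm_le
  mem_init := (hF l.nonempty_of_neBot.some).mem_init
  weak_eq φ hφ := by
    have hlim := (hν.mul (hFg _ (integrable_laplacian hφ.1))).const_sub (-∫ x, f₀ x * φ 0 x)
    rw [zero_mul, sub_zero] at hlim
    refine tendsto_nhds_unique (hFg _ (integrable_transport hu hφ.1)) (hlim.congr fun i => ?_)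
    exact ((hF i).integral_transport_eq hu (hFC i) hφ).symm

theorem weakStarTendsto_of_unique (hν : Tendsto ν l (𝓝 0)) (hu : MemMixed T 1 1 u)
    (hF : ∀ i, IsWeakSolADE T (ν i) u f₀ (F i))
    (hFC : ∀ i, AEBoundedBy C (fun z : ℝ × Torus d => F i z.1 z.2) (spaceTime d T))
    (huniq : IsUniqueBoundedSolTE T u f₀ f) :
    WeakStarTendsto (spaceTime d T) (fun i z => F i z.1 z.2) l fun z => f z.1 z.2 := by
  refine fun h hh => tendsto_iff_ultrafilter _ _ _ |>.2 fun U hU => ?_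
  obtain ⟨g, hgC, hFg⟩ := exists_weakStarTendsto U hFC
  have hg : IsWeakSolTE T u f₀ fun t x => g (t, x) :=
    isWeakSolTE_of_weakStarTendsto (hν.mono_left hU) hu hF hFC hgC hFg
  have hgf := huniq.2.2 _ (AEBoundedBy.memMixed hgC ∞ ∞) hg
  rw [← integral_congr_ae (hgf.mono fun z hz => congrArg (· * h z) hz)]
  exact hFg h hh

theorem IsWeakSolTE.isWeakSolADE_zero (hf : IsWeakSolTE T u f₀ f) : IsWeakSolADE T 0 u f₀ f where
  mem := hf.mem
  mem_flux := hf.mem_flux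
  mem_init := hf.mem_init
  weak_eq φ hφ := by simpa using hf.weak_eq φ hφ

theorem integrable_flux_inner_grad {h : Torus d → ℝ}
    (hflux : MemMixed T 1 1 fun t x => f t x • u t x) (hh : IsSmooth fun _ : ℝ => h) :
    Integrable (fun z : ℝ × Torus d => f z.1 z.2 * inner ℝ (u z.1 z.2) (grad h z.2))
      (spaceTime d T) := by
  simpa only [inner_smul_left, conj_trivial] using integrable_inner_grad hflux hh

theorem integrable_mul_isSmooth (hf : MemMixed T 1 1 f) (hφ : IsSmooth φ) :
    Integrable (fun z : ℝ × Torus d => f z.1 z.2 * φ z.1 z.2) (spaceTime d T) := by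
  obtain ⟨B, hB⟩ := hφ.exists_aeBoundedBy T
  exact (memMixed_one_iff.1 hf).mul_bdd hB.aestronglyMeasurable hB.ae_norm_le

theorem IsWeakSolADE.integrable_flux_add_laplacian {ν : ℝ} {h : Torus d → ℝ}
    (hf : IsWeakSolADE T ν u f₀ f) (hh : IsSmooth fun _ : ℝ => h) :
    Integrable (fun z : ℝ × Torus d =>
      f z.1 z.2 * (inner ℝ (u z.1 z.2) (grad h z.2) + ν * laplacian h z.2)) (spaceTime d T) := by
  refine ((integrable_flux_inner_grad hf.mem_flux hh).add
    ((integrable_mul_isSmooth hf.mem hh.laplacian).const_mul ν)).congr (.of_forall fun z => ?_)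
  simp only [Pi.add_apply]
  ring

theorem IsWeakSolADE.ae_integral_mul_eq {ν : ℝ} {h : Torus d → ℝ}
    (hf : IsWeakSolADE T ν u f₀ f) (hh : IsSmooth fun _ : ℝ => h) :
    ∀ᵐ t ∂timeMeasure T, ∫ x, f t x * h x = (∫ x, f₀ x * h x) +
      ∫ z, f z.1 z.2 * (inner ℝ (u z.1 z.2) (grad h z.2) + ν * laplacian h z.2)
        ∂spaceTime d t := by
  refine ae_integral_slice_eq_of_weak (integrable_mul_isSmooth hf.mem hh)
    (hf.integrable_flux_add_laplacian hh) fun η hη ⟨b, hbT, hηb⟩ => ?_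
  have hweak := hf.weak_eq (fun t x => η t * h x)
    ⟨isSmooth_mul hη hh, b, hbT, fun t ht x => mul_eq_zero_of_left (hηb t ht) (h x)⟩
  simp only [timeDeriv_mul, grad_const_mul, laplacian_const_mul, inner_smul_right,
    mul_left_comm (f₀ _), integral_const_mul] at hweak
  rw [mul_comm _ (η 0), ← hweak]
  congr 1 with z
  ring

theorem IsWeakSolTE.ae_integral_eq (hf : IsWeakSolTE T u f₀ f) :
    ∀ᵐ t ∂timeMeasure T, ∫ x, f t x = ∫ x, f₀ x := by
  have hgrad (x : Torus d) : grad (fun _ => (1 : ℝ)) x = 0 := by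
    ext i
    simp [grad, partialDeriv]
  simpa [hgrad] using hf.isWeakSolADE_zero.ae_integral_mul_eq (h := fun _ => 1) contDiff_const

/-- The bounded continuous function `s ↦ min(|s|, |C|)^2`, a renormalisation that agrees with the
square on `[-|C|, |C|]`. -/
noncomputable def truncatedSq (C : ℝ) : ℝ →ᵇ ℝ :=
  .ofNormedAddCommGroup (fun s => min |s| |C| ^ 2) (by fun_prop) (|C| ^ 2) fun s => by
    rw [Real.norm_eq_abs, abs_of_nonneg (sq_nonneg _)]
    exact pow_le_pow_left₀ (by positivity) (min_le_right _ _) 2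

theorem truncatedSq_apply {s : ℝ} (hs : |s| ≤ |C|) : truncatedSq C s = s ^ 2 :=
  (congrArg (· ^ 2) (min_eq_left hs)).trans (sq_abs s)

theorem AEBoundedBy.integral_truncatedSq {α : Type*} [MeasurableSpace α] {μ : Measure α}
    {w : α → ℝ} (hw : AEBoundedBy D w μ) (hDC : D ≤ C) :
    ∫ x, truncatedSq C (w x) ∂μ = ∫ x, w x ^ 2 ∂μ :=
  integral_congr_ae <| hw.ae_norm_le.mono fun _ hx =>
    truncatedSq_apply ((hx.trans hDC).trans (le_abs_self C))

theorem IsRenormalised.ae_integral_sq_eq (hren : IsRenormalised T u f₀ f)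
    (hfC : AEBoundedBy C (fun z : ℝ × Torus d => f z.1 z.2) (spaceTime d T))
    (hf₀D : AEBoundedBy D f₀ volume) :
    ∀ᵐ t ∂timeMeasure T, ∫ x, f t x ^ 2 = ∫ x, f₀ x ^ 2 := by
  filter_upwards [(hren.2 (truncatedSq (max C D))).ae_integral_eq, hfC.ae_slice] with t ht htC
  rwa [htC.integral_truncatedSq (le_max_left C D),
    hf₀D.integral_truncatedSq (le_max_right C D)] at ht

theorem integral_sq_le_of_ae_slice
    (hfC : AEBoundedBy C (fun z : ℝ × Torus d => f z.1 z.2) (spaceTime d T))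
    (hgD : AEBoundedBy D (fun z : ℝ × Torus d => g z.1 z.2) (spaceTime d T))
    (hle : ∀ᵐ t ∂timeMeasure T, ∫ x, f t x ^ 2 ≤ ∫ x, g t x ^ 2) :
    ∫ z, f z.1 z.2 ^ 2 ∂spaceTime d T ≤ ∫ z, g z.1 z.2 ^ 2 ∂spaceTime d T := by
  have hf2 := (hfC.memLp 2).integrable_sq
  have hg2 := (hgD.memLp 2).integrable_sq
  rw [integral_prod _ hf2, integral_prod _ hg2]
  exact integral_mono_ae hf2.integral_prod_left hg2.integral_prod_left hle

end VanishingViscosityLimit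

section UniformInTime

variable {d : ℕ} {T : ℝ} {u : ℝ → Torus d → EuclideanSpace ℝ (Fin d)} {f₀ h : Torus d → ℝ}
  {f : ℝ → Torus d → ℝ} {C D ε : ℝ}

theorem IsWeakSolADE.ae_abs_integral_sub_mul_le {ν : ℝ} {F : ℝ → Torus d → ℝ}
    (hF : IsWeakSolADE T ν u f₀ F) (hf : IsWeakSolTE T u f₀ f)
    (hFC : AEBoundedBy C (fun z : ℝ × Torus d => F z.1 z.2) (spaceTime d T))
    (hh : IsSmooth fun _ : ℝ => h) :
    ∀ᵐ t ∂timeMeasure T, |∫ x, (F t x - f t x) * h x| ≤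
      (∫ z, |F z.1 z.2 - f z.1 z.2| * |inner ℝ (u z.1 z.2) (grad h z.2)| ∂spaceTime d T) +
        |ν| * (C * ∫ z : ℝ × Torus d, |laplacian h z.2| ∂spaceTime d T) := by
  let A (z : ℝ × Torus d) : ℝ := (F z.1 z.2 - f z.1 z.2) * inner ℝ (u z.1 z.2) (grad h z.2)
  let B (z : ℝ × Torus d) : ℝ := ν * (F z.1 z.2 * laplacian h z.2)
  have hA : Integrable A (spaceTime d T) :=
    ((integrable_flux_inner_grad hF.mem_flux hh).sub
      (integrable_flux_inner_grad hf.mem_flux hh)).congr (.of_forall fun z => (sub_mul _ _ _).symm)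
  have hB : Integrable B (spaceTime d T) :=
    (integrable_mul_isSmooth hF.mem hh.laplacian).const_mul ν
  have hB_le : ∫ z, |B z| ∂spaceTime d T ≤
      |ν| * (C * ∫ z : ℝ × Torus d, |laplacian h z.2| ∂spaceTime d T) := by
    simp only [B, abs_mul, integral_const_mul]
    have hlap := integrable_laplacian (T := T) hh
    have habs := hFC.norm.abs_integral_mul_le hlap.abs
    simp only [abs_abs] at habs
    exact mul_le_mul_of_nonneg_left ((le_abs_self _).trans habs) (abs_nonneg ν)
  filter_upwards [hF.ae_integral_mul_eq hh, hf.isWeakSolADE_zero.ae_integral_mul_eq hh,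
    (integrable_mul_isSmooth hF.mem hh).prod_right_ae,
    (integrable_mul_isSmooth hf.mem hh).prod_right_ae,
    ae_restrict_mem measurableSet_Icc] with t hFt hft hFh hfh ht
  have hle := spaceTime_mono (d := d) ht.2
  calc |∫ x, (F t x - f t x) * h x| = |∫ z, A z + B z ∂spaceTime d t| := by
        simp only [sub_mul]
        rw [integral_sub hFh hfh, hFt, hft, add_sub_add_left_eq_sub, ← integral_sub
          ((hF.integrable_flux_add_laplacian hh).mono_measure hle)
          ((hf.isWeakSolADE_zero.integrable_flux_add_laplacian hh).mono_measure hle)]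
        congr 2 with z
        ring
    _ ≤ ∫ z, |A z + B z| ∂spaceTime d t := abs_integral_le_integral_abs
    _ ≤ ∫ z, |A z + B z| ∂spaceTime d T :=
        integral_mono_measure hle (.of_forall fun _ => abs_nonneg _) (hA.add hB).abs
    _ ≤ ∫ z, (|A z| + |B z|) ∂spaceTime d T :=
        integral_mono (hA.add hB).abs (hA.abs.add hB.abs) fun _ => abs_add_le _ _
    _ = (∫ z, |A z| ∂spaceTime d T) + ∫ z, |B z| ∂spaceTime d T := integral_add hA.abs hB.abs
    _ ≤ _ := add_le_add (by simp only [A, abs_mul, le_refl]) hB_le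

theorem StrongL1Continuous.exists_finite_isSmooth {g : ℝ → Torus d → ℝ}
    (hg : StrongL1Continuous T g) (hε : 0 < ε) :
    ∃ H : Set (Torus d → ℝ), H.Finite ∧ (∀ h ∈ H, IsSmooth fun _ : ℝ => h) ∧
      ∀ t ∈ Icc 0 T, ∃ h ∈ H, ∫ x, |g t x - h x| ≤ ε := by
  refine isCompact_Icc.induction_on (p := fun S => ∃ H : Set (Torus d → ℝ), H.Finite ∧
    (∀ h ∈ H, IsSmooth fun _ : ℝ => h) ∧ ∀ t ∈ S, ∃ h ∈ H, ∫ x, |g t x - h x| ≤ ε)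
    ⟨∅, by simp⟩ ?_ ?_ fun s hs => ?_
  · rintro S S' hSS' ⟨H, hH, hH_smooth, hclose⟩
    exact ⟨H, hH, hH_smooth, fun t ht => hclose t (hSS' ht)⟩
  · rintro S S' ⟨H, hH, hH_smooth, hclose⟩ ⟨H', hH', hH'_smooth, hclose'⟩
    refine ⟨H ∪ H', hH.union hH', fun h => Or.rec (hH_smooth h) (hH'_smooth h), ?_⟩
    rintro t (ht | ht)
    · exact (hclose t ht).imp fun _ => And.imp_left Or.inl
    · exact (hclose' t ht).imp fun _ => And.imp_left Or.inr
  · have hgs := memLp_one_iff_integrable.1 (hg.1 s hs)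
    obtain ⟨h, hh, hgh⟩ := exists_isSmooth_integral_abs_sub_le hgs (half_pos hε)
    have hhi : Integrable h volume := hh.integrable_slice 0
    refine ⟨_, inter_mem self_mem_nhdsWithin ((hg.2 s hs).eventually
      (gt_mem_nhds (ENNReal.ofReal_pos.2 (half_pos hε)))), {h}, finite_singleton h, by simpa,
      fun t ⟨ht, hts⟩ => ⟨h, rfl, ?_⟩⟩
    have hgt := memLp_one_iff_integrable.1 (hg.1 t ht)
    have hdist : ∫ x, |g t x - g s x| ≤ ε / 2 := by
      rw [← ENNReal.ofReal_le_ofReal_iff (half_pos hε).le]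
      exact (ofReal_integral_norm_eq_lintegral_enorm (hgt.sub hgs)).trans_le
        (eLpNorm_one_eq_lintegral_enorm.symm.trans_le hts.le)
    calc ∫ x, |g t x - h x| ≤ ∫ x, (|g t x - g s x| + |g s x - h x|) :=
          integral_mono (hgt.sub hhi).abs ((hgt.sub hgs).abs.add (hgs.sub hhi).abs)
            fun x => abs_sub_le _ _ _
      _ = (∫ x, |g t x - g s x|) + ∫ x, |g s x - h x| :=
          integral_add (hgt.sub hgs).abs (hgs.sub hhi).abs
      _ ≤ ε := by linarith

theorem AEBoundedBy.integral_sub_sq_le {α : Type*} [MeasurableSpace α] {μ : Measure α}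
    [IsFiniteMeasure μ] {a b h : α → ℝ} (ha : AEBoundedBy C a μ) (hb : AEBoundedBy D b μ)
    (hh : Integrable h μ) (hab : ∫ x, a x ^ 2 ∂μ ≤ ∫ x, b x ^ 2 ∂μ) :
    ∫ x, (a x - b x) ^ 2 ∂μ ≤
      2 * |∫ x, (a x - b x) * h x ∂μ| + 2 * ((C + D) * ∫ x, |b x - h x| ∂μ) := by
  have hw := ha.sub hb
  have hbh : Integrable (fun x => b x - h x) μ := hb.integrable.sub hh
  have hsplit : ∫ x, (a x - b x) * b x ∂μ =
      (∫ x, (a x - b x) * h x ∂μ) + ∫ x, (a x - b x) * (b x - h x) ∂μ := by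
    rw [← integral_add (hw.integrable_mul hh) (hw.integrable_mul hbh)]
    congr 1 with x
    ring
  have hsq := VanishingViscosity.integral_sub_sq_le (ha.memLp 2) (hb.memLp 2) hab
  have hrest := neg_le_of_abs_le (hw.abs_integral_mul_le hbh)
  have hmain := neg_abs_le (∫ x, (a x - b x) * h x ∂μ)
  rw [hsplit] at hsq
  linarith

variable {ι : Type*} {l : Filter ι} {ν : ι → ℝ} {F : ι → ℝ → Torus d → ℝ}

theorem eventually_ae_abs_integral_sub_mul_le (hν : Tendsto ν l (𝓝 0)) (hu : MemMixed T 1 1 u)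
    (hF : ∀ i, IsWeakSolADE T (ν i) u f₀ (F i)) (hf : IsWeakSolTE T u f₀ f)
    (hFC : ∀ i, AEBoundedBy C (fun z : ℝ × Torus d => F i z.1 z.2) (spaceTime d T))
    (hFf : WeakStarTendsto (spaceTime d T) (fun i z => |F i z.1 z.2 - f z.1 z.2|) l 0)
    (hh : IsSmooth fun _ : ℝ => h) (hε : 0 < ε) :
    ∀ᶠ i in l, ∀ᵐ t ∂timeMeasure T, |∫ x, (F i t x - f t x) * h x| ≤ ε := by
  have hlim := (hFf _ (integrable_inner_grad hu hh).abs).add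
    (hν.abs.mul_const (C * ∫ z : ℝ × Torus d, |laplacian h z.2| ∂spaceTime d T))
  simp only [Pi.zero_apply, zero_mul, integral_zero, abs_zero, add_zero] at hlim
  filter_upwards [hlim.eventually_le_const hε] with i hi
  filter_upwards [(hF i).ae_abs_integral_sub_mul_le hf (hFC i) hh] with t ht using ht.trans hi

theorem eventually_ae_integral_sub_sq_le (hν : Tendsto ν l (𝓝 0)) (hu : MemMixed T 1 1 u)
    (hF : ∀ i, IsWeakSolADE T (ν i) u f₀ (F i)) (hf : IsWeakSolTE T u f₀ f)
    (hFC : ∀ i, AEBoundedBy C (fun z : ℝ × Torus d => F i z.1 z.2) (spaceTime d T))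
    (hfD : AEBoundedBy D (fun z : ℝ × Torus d => f z.1 z.2) (spaceTime d T))
    (hFf : WeakStarTendsto (spaceTime d T) (fun i z => |F i z.1 z.2 - f z.1 z.2|) l 0)
    (hle : ∀ i, ∀ᵐ t ∂timeMeasure T, ∫ x, F i t x ^ 2 ≤ ∫ x, f t x ^ 2)
    (hcont : MemC0L1 T f) (hε : 0 < ε) :
    ∀ᶠ i in l, ∀ᵐ t ∂timeMeasure T, ∫ x, (F i t x - f t x) ^ 2 ≤ ε := by
  obtain ⟨g, hfg, hg⟩ := hcont
  obtain ⟨δ, hδ, hδε⟩ : ∃ δ > 0, 2 * ((|C| + |D|) * δ) ≤ ε / 2 :=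
    ⟨ε / (4 * (|C| + |D| + 1)), by positivity, by
      field_simp
      nlinarith [abs_nonneg C, abs_nonneg D]⟩
  obtain ⟨H, hH, hH_smooth, hclose⟩ := hg.exists_finite_isSmooth hδ
  have htest : ∀ᶠ i in l, ∀ h ∈ H, ∀ᵐ t ∂timeMeasure T,
      |∫ x, (F i t x - f t x) * h x| ≤ ε / 4 :=
    (eventually_all_finite hH).2 fun h hh => eventually_ae_abs_integral_sub_mul_le hν hu hF hf hFC
      hFf (hH_smooth h hh) (by positivity)
  filter_upwards [htest] with i hi
  filter_upwards [(ae_ball_iff hH.countable).2 hi, (hFC i).ae_slice, hfD.ae_slice, hle i, hfg,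
    ae_restrict_mem measurableSet_Icc] with t htest_t hFt hft hle_t hfg_t ht
  obtain ⟨h, hh, hgh⟩ := hclose t ht
  have hhi : Integrable h volume := (hH_smooth h hh).integrable_slice 0
  have hfh : ∫ x, |f t x - h x| ≤ δ := by
    rwa [integral_congr_ae (hfg_t.mono fun x hx => congrArg (|· - h x|) hx)]
  have hbound := (hFt.mono (le_abs_self C)).integral_sub_sq_le (hft.mono (le_abs_self D)) hhi hle_t
  have hrest := mul_le_mul_of_nonneg_left hfh (by positivity : 0 ≤ |C| + |D|)
  linarith [htest_t h hh]

end UniformInTime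

section MixedNormConvergence

variable {d : ℕ} {T : ℝ} {ι : Type*} {l : Filter ι} {F : ι → ℝ → Torus d → ℝ}
  {f : ℝ → Torus d → ℝ} {C D : ℝ} {p : ℝ≥0∞}

theorem tendsto_mixedNorm_self
    (hFC : ∀ i, AEBoundedBy C (fun z : ℝ × Torus d => F i z.1 z.2) (spaceTime d T))
    (hfD : AEBoundedBy D (fun z : ℝ × Torus d => f z.1 z.2) (spaceTime d T))
    (hlim : Tendsto (fun i => ∫ z, (F i z.1 z.2 - f z.1 z.2) ^ 2 ∂spaceTime d T) l (𝓝 0))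
    (hp1 : 1 ≤ p) (hp : p ≠ ∞) :
    Tendsto (fun i => mixedNorm T p p fun t x => F i t x - f t x) l (𝓝 0) := by
  refine ENNReal.tendsto_nhds_zero.2 fun ε hε => ?_
  obtain ⟨δ, hδ, hδε⟩ := exists_pos_forall_eLpNorm_le (spaceTime d T) (C + D) hp1 hp hε
  filter_upwards [hlim.eventually_le_const hδ] with i hi
  have hsub := (hFC i).sub hfD
  exact (mixedNorm_self (f := fun t x => F i t x - f t x) hsub.aestronglyMeasurable
    (zero_lt_one.trans_le hp1).ne' hp).trans_le (hδε _ hsub hi)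

theorem tendsto_mixedNorm_top
    (hFC : ∀ i, AEBoundedBy C (fun z : ℝ × Torus d => F i z.1 z.2) (spaceTime d T))
    (hfD : AEBoundedBy D (fun z : ℝ × Torus d => f z.1 z.2) (spaceTime d T))
    (hlim : ∀ δ > 0, ∀ᶠ i in l, ∀ᵐ t ∂timeMeasure T, ∫ x, (F i t x - f t x) ^ 2 ≤ δ)
    (hp1 : 1 ≤ p) (hp : p ≠ ∞) :
    Tendsto (fun i => mixedNorm T ∞ p fun t x => F i t x - f t x) l (𝓝 0) := by
  refine ENNReal.tendsto_nhds_zero.2 fun ε hε => ?_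
  obtain ⟨δ, hδ, hδε⟩ :=
    exists_pos_forall_eLpNorm_le (volume : Measure (Torus d)) (C + D) hp1 hp hε
  filter_upwards [hlim δ hδ] with i hi
  rw [mixedNorm_top_le_iff]
  filter_upwards [hi, ((hFC i).sub hfD).ae_slice] with t ht hsub using hδε _ hsub ht

end MixedNormConvergence

theorem IsRepresentative.ae_eLpNorm_le {d : ℕ} {T : ℝ} {f g : ℝ → Torus d → ℝ} {f₀ : Torus d → ℝ}
    {p : ℝ≥0∞} (hfg : IsRepresentative T f g) (hg : InitialLpInequality T f₀ g) (hp : 1 ≤ p) :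
    ∀ᵐ t ∂timeMeasure T, eLpNorm (f t) p volume ≤ eLpNorm f₀ p volume := by
  filter_upwards [hfg, ae_restrict_mem measurableSet_Icc] with t hfgt ht
  exact (eLpNorm_congr_ae hfgt).trans_le (hg p hp t ht)

theorem IsRenormalised.ae_integral_sq_le {d : ℕ} {T C D : ℝ}
    {u : ℝ → Torus d → EuclideanSpace ℝ (Fin d)} {f₀ : Torus d → ℝ} {f F : ℝ → Torus d → ℝ}
    (hren : IsRenormalised T u f₀ f) (hf₀ : MemLp f₀ ∞ volume)
    (hFC : AEBoundedBy C (fun z : ℝ × Torus d => F z.1 z.2) (spaceTime d T))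
    (hfD : AEBoundedBy D (fun z : ℝ × Torus d => f z.1 z.2) (spaceTime d T))
    (hF : ∀ᵐ t ∂timeMeasure T, eLpNorm (F t) 2 volume ≤ eLpNorm f₀ 2 volume) :
    ∀ᵐ t ∂timeMeasure T, ∫ x, F t x ^ 2 ≤ ∫ x, f t x ^ 2 := by
  have hf₀_bdd := aeBoundedBy_of_eLpNorm_top_le hf₀.1 hf₀.2.ne le_rfl
  filter_upwards [hren.ae_integral_sq_eq hfD hf₀_bdd, hFC.ae_slice, hF] with t hft hFt hle
  exact hft ▸ integral_sq_le_of_eLpNorm_le (hFt.memLp 2) (hf₀_bdd.memLp 2) hle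

end VanishingViscosity

theorem proposition3p1_general {d : ℕ} {T : ℝ} {u : ℝ → Torus d → EuclideanSpace ℝ (Fin d)}
    (hu : MemMixed T 1 1 u) {f₀ : Torus d → ℝ} (hf₀ : MemLp f₀ ∞ volume)
    {f : ℝ → Torus d → ℝ} (huniq : IsUniqueBoundedSolTE T u f₀ f)
    (hren : IsRenormalised T u f₀ f) {F : ℝ → ℝ → Torus d → ℝ}
    (hF : ∀ ν > 0, IsWeakSolADE T ν u f₀ (F ν)) {C : ℝ≥0∞} (hC : C ≠ ∞)
    (hFC : ∀ ν > 0, mixedNorm T ∞ ∞ (F ν) ≤ C)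
    (hF2 : ∀ ν > 0, ∀ᵐ t ∂timeMeasure T, eLpNorm (F ν t) 2 volume ≤ eLpNorm f₀ 2 volume) :
    TendstoWeakStar T F f ∧
    (∀ p : ℝ≥0∞, 1 ≤ p → p ≠ ∞ → TendstoMixed T p p F f) ∧
    (MemC0L1 T f → ∀ p : ℝ≥0∞, 1 ≤ p → p ≠ ∞ → TendstoMixed T ∞ p F f) := by
  have hFpos (ν : Ioi (0 : ℝ)) := hF ν ν.2
  have hFbdd (ν : Ioi (0 : ℝ)) :=
    aeBoundedBy_of_mixedNorm_le (hF ν ν.2).mem.1 hC (hFC ν ν.2)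
  have hfbdd := aeBoundedBy_of_mixedNorm_le huniq.1.1 huniq.1.2.ne le_rfl
  have hsq (ν : Ioi (0 : ℝ)) := hren.ae_integral_sq_le hf₀ (hFbdd ν) hfbdd (hF2 ν ν.2)
  have hν : Tendsto ((↑) : Ioi (0 : ℝ) → ℝ) atBot (𝓝 0) :=
    (tendsto_comp_coe_Ioi_atBot (.of_dense _)).2 nhdsWithin_le_nhds
  have hweak := weakStarTendsto_of_unique hν hu hFpos hFbdd huniq
  have hL2 := hweak.tendsto_integral_sub_sq hFbdd hfbdd fun ν =>
    integral_sq_le_of_ae_slice (hFbdd ν) hfbdd (hsq ν)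
  have hmem (p q : ℝ≥0∞) (ν : ℝ) (hν : ν > 0) : MemMixed T p q (F ν) :=
    (hFbdd ⟨ν, hν⟩).memMixed p q
  refine ⟨⟨hmem ∞ ∞, huniq.1, fun g hg => ?_⟩, fun p hp1 hp => ⟨hmem p p, hfbdd.memMixed p p, ?_⟩,
    fun hcont p hp1 hp => ⟨hmem ∞ p, hfbdd.memMixed ∞ p, ?_⟩⟩ <;>
    refine (tendsto_comp_coe_Ioi_atBot (.of_dense _)).1 ?_
  · exact hweak _ (memMixed_one_iff.1 hg)
  · exact tendsto_mixedNorm_self hFbdd hfbdd hL2 hp1 hp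
  · have habs := weakStarTendsto_abs_zero (fun ν => (hFbdd ν).sub hfbdd) hL2
    exact tendsto_mixedNorm_top hFbdd hfbdd (fun δ hδ => eventually_ae_integral_sub_sq_le hν hu
      hFpos huniq.2.1 hFbdd hfbdd habs hsq hcont hδ) hp1 hp

theorem proposition3p1 (d : ℕ) (T : ℝ) (hT : 0 < T)
    (u : ℝ → Torus d → EuclideanSpace ℝ (Fin d))
    (hu : MemMixed T 1 1 u) (hdiv : IsDivFree T u)
    (f₀ : Torus d → ℝ) (hf₀ : MemLp f₀ ∞ volume)
    (f : ℝ → Torus d → ℝ)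
    (huniq : IsUniqueBoundedSolTE T u f₀ f)
    (hren : IsRenormalised T u f₀ f)
    (F : ℝ → ℝ → Torus d → ℝ)
    (hF : ∀ ν > 0, IsWeakSolADE T ν u f₀ (F ν))
    (hFcont : ∀ ν > 0, ∃ g, IsRepresentative T (F ν) g ∧
      WeakStarContinuous T g ∧ InitialLpInequality T f₀ g) :
    TendstoWeakStar T F f ∧
    (∀ p : ℝ≥0∞, 1 ≤ p → p ≠ ∞ → TendstoMixed T p p F f) ∧
    (MemC0L1 T f → ∀ p : ℝ≥0∞, 1 ≤ p → p ≠ ∞ → TendstoMixed T ∞ p F f) := by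
  choose! g hFg _ hg using hFcont
  exact proposition3p1_general hu hf₀ huniq hren hF hf₀.2.ne
    (fun ν hν => mixedNorm_top_le_iff.2 ((hFg ν hν).ae_eLpNorm_le (hg ν hν) le_top))
    fun ν hν => (hFg ν hν).ae_eLpNorm_le (hg ν hν) one_le_two
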